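/- **Setting.** Consider the triangular grid of the plane. Its edges are directed so that the three sides of every unit triangle form a directed 3-cycle ("positive direction"; all parallel edges have the same direction). A *domain* $\mathcal D$ is a finite union of unit triangles; its *contour* is the set of grid edges belonging to exactly one of its triangles. A *lozenge* is the union of two triangles with a common side; a *tiling* of $\mathcal D$ is a set of lozenges with pairwise disjoint interiors whose union is $\mathcal D$. A *height function* of a tiling $T$ is a function $h$ from the vertices of $\mathcal D$ to $\mathbb Z$ that increases by $1$ along every positively directed edge of $\mathcal D$ not cutting a lozenge of $T$ (hence decreases by $2$ along the other ones). We assume that $\mathcal D$ is tileable and that the lattice theory of its tilings applies, i.e. that height functions are consistent: any two tilings of $\mathcal D$ have height functions that agree on the contour of $\mathcal D$ (this holds if $\mathcal D$ is simply connected). Tilings are ordered by $T\preccurlyeq T'$ iff $h_T\le h_{T'}$ for height functions $h_T,h_{T'}$ agreeing on the contour; there are then a minimal and a maximal tiling. A vertex of $\mathcal D$ is *solid* if it has the same height in both (heights agreeing on the contour). **Definitions.** - A *$T$-valid cycle* in $\mathcal D$ is either a single vertex or a closed repetition-free path along edges of $\mathcal D$ with $|h_T(v)-h_T(v')|=1$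 for consecutive vertices $v,v'$. A *sub-domain* of $\mathcal D$ is a part $F\subseteq\mathcal D$, union of triangles, whose contour is a $T$-valid cycle for some tiling $T$ of $\mathcal D$ (the case of a single vertex corresponding to an $F$ without triangles). - A *fracture line* of $\mathcal D$ is a $T$-valid cycle (for some tiling $T$ of $\mathcal D$) all of whose vertices are solid. - A *fracture zone* of $\mathcal D$ is a sub-domain, not reduced to a point, whose contour is a fracture line $L$ and which contains no other fracture line, apart from those reduced to a single vertex. - A sub-domain $F$ of $\mathcal D$ is *pre-fertile* if it is connected and tileable, at least one of its vertices is not on its contour, no vertex of $F$ off its contour is solid in $\mathcal D$, and two vertices of its contour are joined by a grid edge contained in $F$ if and only if they are neighbours on the contour. It is *fertile* if it is pre-fertile and maximal for fertile union: for every pre-fertile sub-domain $F'$ such that $F\cup F'$ is a pre-fertile sub-domain, $F\cup F'=F$. **Theorem (Fracture theorem).** Every fracture zone of $\mathcal D$ is either a fertile zone (a fertile sub-domain of $\mathcal D$) or a single lozenge. -/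

import Mathlib

namespace Lozenge

/-- Vertices of the triangular grid: `(i, j)` stands for the point `i • e₁ + j • e₂` of the plane,
where `e₁`, `e₂` are unit vectors at an angle of 60 degrees. -/
abbrev Vertex := ℤ × ℤ

/-- `PosStep u v`: the grid edge from `u` to `v` is positively directed, i.e. labelled by one of
the letters `a = e₁`, `b = e₂ - e₁`, `c = -e₂`. These satisfy `a + b + c = 0`, and each unit
triangle is bounded by one edge of each label, forming a directed 3-cycle. -/
def PosStep (u v : Vertex) : Prop :=
  v = u + (1, 0) ∨ v = u + (-1, 1) ∨ v = u + (0, -1)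

/-- The triangular grid, as a graph. -/
def grid : SimpleGraph Vertex := SimpleGraph.fromRel PosStep

/-- Unit triangles of the grid: `(p, true)` has corners `p, p + e₁, p + e₂`, and
`(p, false)` has corners `p + e₁, p + e₂, p + e₁ + e₂`. -/
abbrev Triangle := Vertex × Bool

namespace Triangle

/-- The three corners of a triangle. -/
def corners (t : Triangle) : Finset Vertex :=
  if t.2 then {t.1, t.1 + (1, 0), t.1 + (0, 1)}
  else {t.1 + (1, 0), t.1 + (0, 1), t.1 + (1, 1)}

/-- The three sides of a triangle. -/
def sides (t : Triangle) : Finset (Sym2 Vertex) :=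
  if t.2 then {s(t.1, t.1 + (1, 0)), s(t.1 + (1, 0), t.1 + (0, 1)), s(t.1 + (0, 1), t.1)}
  else {s(t.1 + (1, 0), t.1 + (0, 1)), s(t.1 + (0, 1), t.1 + (1, 1)),
    s(t.1 + (1, 1), t.1 + (1, 0))}

/-- Two distinct triangles are adjacent when they have a common side. -/
def adjacency : SimpleGraph Triangle :=
  SimpleGraph.fromRel fun t t' => ∃ e, e ∈ t.sides ∧ e ∈ t'.sides

end Triangle

/-- A domain is a finite union of triangles of the grid. -/
abbrev Domain := Finset Triangle

namespace Domain

/-- The vertices of a domain. -/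
def vertices (D : Domain) : Finset Vertex := D.biUnion Triangle.corners

/-- The grid edges contained in a domain. -/
def edges (D : Domain) : Finset (Sym2 Vertex) := D.biUnion Triangle.sides

/-- The contour of a domain: the edges that belong to exactly one of its triangles. -/
def contour (D : Domain) : Set (Sym2 Vertex) := {e | ∃! t, t ∈ D ∧ e ∈ t.sides}

/-- The vertices on the contour of a domain. -/
def contourVertices (D : Domain) : Set Vertex := {v | ∃ e ∈ D.contour, v ∈ e}

/-- Connectedness of a domain: any two of its triangles are joined by a chain of triangles of the
domain in which consecutive triangles have a common side. -/
def IsConnected (D : Domain) : Prop :=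
  (Triangle.adjacency.induce (D : Set Triangle)).Connected

end Domain

/-- A lozenge is the union of two distinct triangles with a common side. -/
def IsLozenge (F : Domain) : Prop :=
  ∃ t t' : Triangle, Triangle.adjacency.Adj t t' ∧ F = {t, t'}

/-- `T` is a tiling of `D`: a set of lozenges with pairwise disjoint interiors whose union
is `D`. -/
def IsTiling (D : Domain) (T : Finset Domain) : Prop :=
  (∀ l ∈ T, IsLozenge l) ∧ (T : Set Domain).PairwiseDisjoint id ∧ T.biUnion id = D

/-- A domain is tileable if it admits a tiling. -/
def IsTileable (D : Domain) : Prop := ∃ T, IsTiling D T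

/-- The edge `e` cuts the interior of a lozenge of `T`, i.e. it is the common side of the two
triangles of that lozenge. -/
def CutsTile (T : Finset Domain) (e : Sym2 Vertex) : Prop :=
  ∃ l ∈ T, ∀ t ∈ l, e ∈ t.sides

/-- `h` is a height function of the tiling `T` of `D`: the height increases by `1` along each
positively directed edge of `D` that does not cut a lozenge of `T`. (The values of `h` outside
the vertices of `D` are irrelevant.) -/
def IsHeight (D : Domain) (T : Finset Domain) (h : Vertex → ℤ) : Prop :=
  ∀ u v, PosStep u v → s(u, v) ∈ D.edges → ¬ CutsTile T s(u, v) → h v = h u + 1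

/-- `h` and `h'` are height functions of the tilings `T` and `T'` of `D` that take the same values
on the contour of `D`, so that they can be compared. -/
def AreNormalizedHeights (D : Domain) (T T' : Finset Domain) (h h' : Vertex → ℤ) : Prop :=
  IsHeight D T h ∧ IsHeight D T' h' ∧ ∀ v ∈ D.contourVertices, h v = h' v

/-- The standing assumption on domains (satisfied by all simply connected ones) under which the
tilings form a distributive lattice connected by flips: every tiling has a height function, and
the heights on the contour do not depend on the tiling. -/
def HasConsistentHeights (D : Domain) : Prop :=
  ∀ T T', IsTiling D T → IsTiling D T' → ∃ h h', AreNormalizedHeights D T T' h h'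

/-- The order on the tilings of `D` given by the height functions. -/
def TilingLE (D : Domain) (T T' : Finset Domain) : Prop :=
  ∃ h h', AreNormalizedHeights D T T' h h' ∧ ∀ v ∈ D.vertices, h v ≤ h' v

/-- `T` is the minimal tiling of `D`. -/
def IsMinimalTiling (D : Domain) (T : Finset Domain) : Prop :=
  IsTiling D T ∧ ∀ T', IsTiling D T' → TilingLE D T T'

/-- `T` is the maximal tiling of `D`. -/
def IsMaximalTiling (D : Domain) (T : Finset Domain) : Prop :=
  IsTiling D T ∧ ∀ T', IsTiling D T' → TilingLE D T' T

/-- A vertex of `D` is solid if it has the same height in the minimal and in the maximal tiling. -/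
def IsSolid (D : Domain) (v : Vertex) : Prop :=
  v ∈ D.vertices ∧ ∃ Tmin Tmax hmin hmax, IsMinimalTiling D Tmin ∧ IsMaximalTiling D Tmax ∧
    AreNormalizedHeights D Tmin Tmax hmin hmax ∧ hmin v = hmax v

/-- The closed path `C` lies in the domain `F`. -/
def LiesIn {v : Vertex} (C : grid.Walk v v) (F : Domain) : Prop :=
  v ∈ F.vertices ∧ ∀ e ∈ C.edges, e ∈ F.edges

/-- `C` is a `T`-valid cycle in `D`: a closed repetition-free path in `D`, possibly reduced to a
single vertex, along each edge of which the height of `T` varies by `1` in absolute value. -/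
def IsValidCycle (D : Domain) (T : Finset Domain) {v : Vertex} (C : grid.Walk v v) : Prop :=
  LiesIn C D ∧ (C.Nil ∨ C.IsCycle) ∧
    ∃ h, IsHeight D T h ∧ ∀ d ∈ C.darts, |h d.snd - h d.fst| = 1

/-- The contour of `F` is the closed path `C` (the domain without triangles being delimited by the
paths that are reduced to a single point). -/
def IsDelimitedBy (F : Domain) {v : Vertex} (C : grid.Walk v v) : Prop :=
  F.contour = {e | e ∈ C.edges}

/-- A sub-domain of `D` is a part of `D` delimited by a `T`-valid cycle for some tiling `T`
of `D`. -/
def IsSubDomain (D F : Domain) : Prop :=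
  F ⊆ D ∧ ∃ T, IsTiling D T ∧ ∃ (v : Vertex) (C : grid.Walk v v),
    IsValidCycle D T C ∧ IsDelimitedBy F C

/-- A fracture line of `D`: a `T`-valid cycle in `D`, for some tiling `T` of `D`, composed only of
solid vertices. -/
def IsFractureLine (D : Domain) {v : Vertex} (C : grid.Walk v v) : Prop :=
  (∃ T, IsTiling D T ∧ IsValidCycle D T C) ∧ ∀ x ∈ C.support, IsSolid D x

/-- A fracture zone of `D`: a sub-domain not reduced to a single point (so, containing a
triangle), delimited by a fracture line and containing no other fracture line. Two closed paths
are regarded as the same line when they have the same edges; the fracture lines reduced to a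
single vertex, of which the vertices on the contour are always examples, are not counted. -/
def IsFractureZone (D F : Domain) : Prop :=
  IsSubDomain D F ∧ F.Nonempty ∧ ∃ (v : Vertex) (L : grid.Walk v v),
    IsFractureLine D L ∧ IsDelimitedBy F L ∧
    ∀ (w : Vertex) (C : grid.Walk w w), IsFractureLine D C → ¬ C.Nil → LiesIn C F →
      ∀ e, e ∈ C.edges ↔ e ∈ L.edges

/-- A pre-fertile sub-domain of `D`: it is connected and tileable, it has a vertex that is not on
its contour, no such vertex is solid in `D`, and two vertices of its contour are joined by a grid
edge contained in it if and only if they are neighbours on the contour. -/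
def IsPreFertile (D F : Domain) : Prop :=
  IsSubDomain D F ∧ F.IsConnected ∧ IsTileable F ∧
    (∃ v ∈ F.vertices, v ∉ F.contourVertices) ∧
    (∀ v ∈ F.vertices, v ∉ F.contourVertices → ¬ IsSolid D v) ∧
    (∀ u ∈ F.contourVertices, ∀ v ∈ F.contourVertices,
      s(u, v) ∈ F.edges ↔ s(u, v) ∈ F.contour)

/-- A fertile zone of `D`: a pre-fertile sub-domain that is maximal for fertile union, i.e. its
union with another pre-fertile sub-domain is never a strictly larger pre-fertile sub-domain. -/
def IsFertile (D F : Domain) : Prop :=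
  IsPreFertile D F ∧ ∀ F', IsPreFertile D F' → IsPreFertile D (F ∪ F') → F ∪ F' = F

end Lozenge

/-!
Let `b` be the height of the maximal tiling. In the maximal tiling no inner vertex of the domain is
a local minimum of the height, so from a solid vertex inside a fracture zone one can descend along
positive edges, whose lower ends are again solid because an edge that rises by `1` in the maximal
tiling rises by at most `1` in the minimal one; dually, one can ascend. If there were a solid vertex
off the contour, a descending and an ascending path from it to the contour would close up, along the
contour, to a second fracture line. Hence the inner vertices are not solid.

If an edge off the contour joins two contour vertices, then it cuts a lozenge of the maximal tiling,
since otherwise it would close up to a second fracture line in the same way. Its ends being solid,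
it also cuts a lozenge of the minimal tiling, so the contour of this lozenge is itself a fracture
line, and the zone is this lozenge. Without such an edge, the zone is pre-fertile; it is maximal,
since its contour, being solid, has to lie on the contour of any larger pre-fertile sub-domain, and
a cycle contains no other domain contour.
-/

namespace Lozenge

section Grid

lemma PosStep.cases {u v : Vertex} (h : PosStep u v) :
    (v.1 = u.1 + 1 ∧ v.2 = u.2) ∨ (v.1 = u.1 - 1 ∧ v.2 = u.2 + 1) ∨
      (v.1 = u.1 ∧ v.2 = u.2 - 1) := by
  rcases h with rfl | rfl | rfl <;> simp <;> omega

lemma PosStep.ne {u v : Vertex} (h : PosStep u v) : u ≠ v := by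
  rintro rfl
  have := h.cases
  omega

lemma PosStep.adj {u v : Vertex} (h : PosStep u v) : grid.Adj u v :=
  ⟨h.ne, .inl h⟩

lemma PosStep.asymm {u v : Vertex} (h : PosStep u v) : ¬ PosStep v u := by
  intro h'
  have := h.cases
  have := h'.cases
  omega

lemma exists_posStep_of_mem_edgeSet {e : Sym2 Vertex} (he : e ∈ grid.edgeSet) :
    ∃ u v, PosStep u v ∧ e = s(u, v) := by
  induction e with
  | _ u v =>
    rcases he.2 with h | h
    exacts [⟨u, v, h, rfl⟩, ⟨v, u, h, Sym2.eq_swap⟩]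

/-- The triangle of shape `(·, true)` that has the grid edge `e` as a side. -/
def upper (e : Sym2 Vertex) : Triangle := (e.inf, true)

/-- The triangle of shape `(·, false)` that has the grid edge `e` as a side. -/
def lower (e : Sym2 Vertex) : Triangle := (e.sup - (1, 1), false)

/-- The lozenge formed by the two triangles that have the grid edge `e` as a side, that is, the
lozenge whose short diagonal is `e`. -/
def diamond (e : Sym2 Vertex) : Domain := {upper e, lower e}

lemma upper_ne_lower (e e' : Sym2 Vertex) : upper e ≠ lower e' := by
  simp [upper, lower]

lemma upper_mem_diamond (e : Sym2 Vertex) : upper e ∈ diamond e := by simp [diamond]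

lemma lower_mem_diamond (e : Sym2 Vertex) : lower e ∈ diamond e := by simp [diamond]

lemma mem_diamond_iff {e : Sym2 Vertex} (he : e ∈ grid.edgeSet) {t : Triangle} :
    t ∈ diamond e ↔ e ∈ t.sides := by
  obtain ⟨⟨a, c⟩, v, h, rfl⟩ := exists_posStep_of_mem_edgeSet he
  obtain ⟨⟨p, q⟩, b⟩ := t
  rcases h with rfl | rfl | rfl <;> cases b <;>
    simp [diamond, Triangle.sides, upper, lower] <;> omega

lemma diamond_injOn : Set.InjOn diamond grid.edgeSet := by
  intro e he e' he' h
  have hupper : upper e ∈ diamond e' := h ▸ upper_mem_diamond e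
  have hlower : lower e ∈ diamond e' := h ▸ lower_mem_diamond e
  obtain ⟨u, v, huv, rfl⟩ := exists_posStep_of_mem_edgeSet he
  obtain ⟨u', v', huv', rfl⟩ := exists_posStep_of_mem_edgeSet he'
  simp only [diamond, upper, lower, Sym2.inf_mk, Sym2.sup_mk, Finset.mem_insert,
    Finset.mem_singleton, Prod.ext_iff, Prod.fst_inf, Prod.snd_inf, Prod.fst_sup, Prod.snd_sup,
    Prod.fst_sub, Prod.snd_sub, sub_left_inj, Bool.true_eq_false, Bool.false_eq_true, and_true,
    and_false, or_false, false_or] at hupper hlower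
  have := huv.cases
  have := huv'.cases
  have : u = u' ∧ v = v' := by
    rw [Prod.ext_iff, Prod.ext_iff]
    omega
  rw [this.1, this.2]

lemma exists_sides_eq (t : Triangle) :
    ∃ u v w, PosStep u v ∧ PosStep v w ∧ PosStep w u ∧
      t.sides = {s(u, v), s(v, w), s(w, u)} := by
  obtain ⟨p, _ | _⟩ := t
  · exact ⟨p + (1, 0), p + (0, 1), p + (1, 1), by simp [PosStep, add_assoc],
      by simp [PosStep, add_assoc], by simp [PosStep, add_assoc], rfl⟩
  · exact ⟨p, p + (1, 0), p + (0, 1), by simp [PosStep], by simp [PosStep, add_assoc],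
      by simp [PosStep, add_assoc], rfl⟩

lemma exists_sides_eq_of_posStep {u v : Vertex} (huv : PosStep u v) {t : Triangle}
    (ht : s(u, v) ∈ t.sides) :
    ∃ w, PosStep v w ∧ PosStep w u ∧ t.sides = {s(u, v), s(v, w), s(w, u)} := by
  obtain ⟨x, y, z, hxy, hyz, hzx, hsides⟩ := exists_sides_eq t
  have eq_of_eq : ∀ {a b}, PosStep a b → s(u, v) = s(a, b) → u = a ∧ v = b := by
    intro a b hab h
    refine (Sym2.eq_iff.1 h).resolve_right ?_
    rintro ⟨rfl, rfl⟩
    exact huv.asymm hab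
  rw [hsides] at ht ⊢
  simp only [Finset.mem_insert, Finset.mem_singleton] at ht
  rcases ht with h | h | h
  · obtain ⟨rfl, rfl⟩ := eq_of_eq hxy h
    exact ⟨z, hyz, hzx, rfl⟩
  · obtain ⟨rfl, rfl⟩ := eq_of_eq hyz h
    exact ⟨x, hzx, hxy, by ext; simp; tauto⟩
  · obtain ⟨rfl, rfl⟩ := eq_of_eq hzx h
    exact ⟨y, hxy, hyz, by ext; simp; tauto⟩

lemma mem_edgeSet_of_mem_sides {t : Triangle} {e : Sym2 Vertex} (h : e ∈ t.sides) :
    e ∈ grid.edgeSet := by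
  obtain ⟨u, v, w, huv, hvw, hwu, hsides⟩ := exists_sides_eq t
  rw [hsides] at h
  simp only [Finset.mem_insert, Finset.mem_singleton] at h
  rcases h with rfl | rfl | rfl
  exacts [huv.adj, hvw.adj, hwu.adj]

lemma mem_corners_of_mem_sides {t : Triangle} {e : Sym2 Vertex} (h : e ∈ t.sides) {v : Vertex}
    (hv : v ∈ e) : v ∈ t.corners := by
  obtain ⟨p, _ | _⟩ := t <;>
    simp only [Triangle.sides, Triangle.corners, Bool.false_eq_true, if_true, if_false,
      Finset.mem_insert, Finset.mem_singleton] at h ⊢ <;>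
    rcases h with rfl | rfl | rfl <;> rw [Sym2.mem_iff] at hv <;> tauto

lemma diamond_eq_pair {t t' : Triangle} (hne : t ≠ t') {e : Sym2 Vertex} (ht : e ∈ t.sides)
    (ht' : e ∈ t'.sides) : diamond e = {t, t'} := by
  have he := mem_edgeSet_of_mem_sides ht
  refine (Finset.eq_of_subset_of_card_le ?_ ?_).symm
  · simp [Finset.insert_subset_iff, mem_diamond_iff he, ht, ht']
  · rw [Finset.card_pair hne]
    exact Finset.card_le_two

lemma adj_upper_lower {e : Sym2 Vertex} (he : e ∈ grid.edgeSet) :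
    Triangle.adjacency.Adj (upper e) (lower e) :=
  ⟨upper_ne_lower e e, .inl ⟨e, (mem_diamond_iff he).1 (upper_mem_diamond e),
    (mem_diamond_iff he).1 (lower_mem_diamond e)⟩⟩

lemma isLozenge_iff_exists_diamond {l : Domain} :
    IsLozenge l ↔ ∃ e ∈ grid.edgeSet, l = diamond e := by
  constructor
  · rintro ⟨t, t', ⟨hne, ⟨e, ht, ht'⟩ | ⟨e, ht', ht⟩⟩, rfl⟩
    all_goals exact ⟨e, mem_edgeSet_of_mem_sides ht, (diamond_eq_pair hne ht ht').symm⟩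
  · rintro ⟨e, he, rfl⟩
    exact ⟨_, _, adj_upper_lower he, rfl⟩

end Grid

section Hexagons

/-- The six neighbours of `v`, in counterclockwise order. The edges from `v` to the even ones are
positively directed, those to the odd ones negatively. -/
def spoke (v : Vertex) (i : Fin 6) : Vertex :=
  v + ![(1, 0), (0, 1), (-1, 1), (-1, 0), (0, -1), (1, -1)] i

/-- The six triangles with corner `v`, in counterclockwise order: `sector v i` lies between
`spoke v i` and `spoke v (i + 1)`. -/
def sector (v : Vertex) : Fin 6 → Triangle :=
  ![(v, true), (v - (1, 0), false), (v - (1, 0), true), (v - (1, 1), false), (v - (0, 1), true),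
    (v - (0, 1), false)]

/-- The hexagon formed by the six triangles with corner `v`. -/
def hexagon (v : Vertex) : Domain := Finset.univ.image (sector v)

lemma posStep_iff_spoke_even {v w : Vertex} :
    PosStep v w ↔ w = spoke v 0 ∨ w = spoke v 2 ∨ w = spoke v 4 := Iff.rfl

lemma posStep_iff_spoke_odd {u v : Vertex} :
    PosStep u v ↔ u = spoke v 1 ∨ u = spoke v 3 ∨ u = spoke v 5 := by
  simp only [PosStep, spoke, Prod.ext_iff, Prod.fst_add, Prod.snd_add, Matrix.cons_val]
  omega

lemma adj_iff_exists_spoke {v w : Vertex} : grid.Adj v w ↔ ∃ i, w = spoke v i := by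
  have hadj : grid.Adj v w ↔ PosStep v w ∨ PosStep w v :=
    ⟨fun h => h.2, fun h => h.elim PosStep.adj fun h => h.adj.symm⟩
  rw [hadj, posStep_iff_spoke_even, posStep_iff_spoke_odd]
  simp only [Fin.exists_fin_succ, IsEmpty.exists_iff]
  change _ ↔ w = spoke v 0 ∨ w = spoke v 1 ∨ w = spoke v 2 ∨ w = spoke v 3 ∨ w = spoke v 4 ∨
    w = spoke v 5 ∨ False
  tauto

lemma adj_spoke (v : Vertex) (i : Fin 6) : grid.Adj v (spoke v i) :=
  adj_iff_exists_spoke.2 ⟨i, rfl⟩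

lemma exists_eq_spoke {e : Sym2 Vertex} (he : e ∈ grid.edgeSet) {v : Vertex} (hv : v ∈ e) :
    ∃ i, e = s(v, spoke v i) := by
  obtain ⟨w, rfl⟩ := hv
  obtain ⟨i, hi⟩ := adj_iff_exists_spoke.1 he
  exact ⟨i, by rw [← hi]⟩

lemma spoke_injective (v : Vertex) : Function.Injective (spoke v) :=
  (add_right_injective v).comp (by decide)

lemma sector_injective (v : Vertex) : Function.Injective (sector v) := by
  intro i j h
  obtain ⟨x, y⟩ := v
  fin_cases i <;> fin_cases j <;> simp_all [sector] <;> omega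

lemma mem_hexagon_iff {v : Vertex} {t : Triangle} : t ∈ hexagon v ↔ v ∈ t.corners := by
  obtain ⟨x, y⟩ := v
  obtain ⟨⟨p, q⟩, _ | _⟩ := t <;>
    simp [hexagon, sector, Triangle.corners, Fin.exists_fin_succ] <;> omega

lemma diamond_spoke (v : Vertex) (i : Fin 6) :
    diamond s(v, spoke v i) = ({i - 1, i} : Finset (Fin 6)).image (sector v) := by
  obtain ⟨x, y⟩ := v
  ext ⟨⟨p, q⟩, _ | _⟩ <;> fin_cases i <;>
    simp [diamond, upper, lower, spoke, sector] <;> omega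

lemma diamond_subset_hexagon {e : Sym2 Vertex} (he : e ∈ grid.edgeSet) {v : Vertex} (hv : v ∈ e) :
    diamond e ⊆ hexagon v := fun _ ht =>
  mem_hexagon_iff.2 (mem_corners_of_mem_sides ((mem_diamond_iff he).1 ht) hv)

end Hexagons

section Contours

variable {D E : Domain} {e : Sym2 Vertex} {v : Vertex}

lemma Domain.edges_mono (h : D ⊆ E) : D.edges ⊆ E.edges :=
  Finset.biUnion_subset_biUnion_of_subset_left _ h

lemma Domain.vertices_mono (h : D ⊆ E) : D.vertices ⊆ E.vertices :=
  Finset.biUnion_subset_biUnion_of_subset_left _ h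

lemma mem_edgeSet_of_mem_edges (h : e ∈ D.edges) : e ∈ grid.edgeSet := by
  obtain ⟨t, -, ht⟩ := Finset.mem_biUnion.1 h
  exact mem_edgeSet_of_mem_sides ht

lemma mem_vertices_of_mem_edges (h : e ∈ D.edges) (hv : v ∈ e) : v ∈ D.vertices := by
  obtain ⟨t, htD, ht⟩ := Finset.mem_biUnion.1 h
  exact Finset.mem_biUnion.2 ⟨t, htD, mem_corners_of_mem_sides ht hv⟩

lemma mem_edges_iff (he : e ∈ grid.edgeSet) : e ∈ D.edges ↔ ∃ t ∈ diamond e, t ∈ D := by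
  simp only [Domain.edges, Finset.mem_biUnion, mem_diamond_iff he, and_comm]

lemma mem_edges_of_diamond_subset (he : e ∈ grid.edgeSet) (h : diamond e ⊆ D) : e ∈ D.edges :=
  (mem_edges_iff he).2 ⟨_, upper_mem_diamond e, h (upper_mem_diamond e)⟩

lemma mem_contour_iff : e ∈ D.contour ↔ e ∈ D.edges ∧ ¬ diamond e ⊆ D := by
  constructor
  · rintro ⟨t, ⟨htD, ht⟩, huniq⟩
    refine ⟨Finset.mem_biUnion.2 ⟨t, htD, ht⟩, fun hsub => upper_ne_lower e e ?_⟩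
    have eq_t : ∀ t' ∈ diamond e, t' = t := fun t' ht' =>
      huniq t' ⟨hsub ht', (mem_diamond_iff (mem_edgeSet_of_mem_sides ht)).1 ht'⟩
    rw [eq_t _ (upper_mem_diamond e), eq_t _ (lower_mem_diamond e)]
  · rintro ⟨he, hsub⟩
    obtain ⟨t, htD, ht⟩ := Finset.mem_biUnion.1 he
    refine ⟨t, ⟨htD, ht⟩, fun t' ⟨ht'D, ht'⟩ => by_contra fun hne => hsub ?_⟩
    rw [diamond_eq_pair hne ht' ht, Finset.insert_subset_iff, Finset.singleton_subset_iff]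
    exact ⟨ht'D, htD⟩

lemma contour_subset_edges : D.contour ⊆ D.edges := fun _ he => (mem_contour_iff.1 he).1

lemma mem_vertices_of_mem_contourVertices (h : v ∈ D.contourVertices) : v ∈ D.vertices := by
  obtain ⟨e, he, hv⟩ := h
  exact mem_vertices_of_mem_edges (contour_subset_edges he) hv

lemma mem_contour_iff_of_diamond_eq (he : e ∈ grid.edgeSet) {t t' : Triangle}
    (h : diamond e = {t, t'}) : e ∈ D.contour ↔ ¬ (t ∈ D ↔ t' ∈ D) := by
  rw [mem_contour_iff, mem_edges_iff he, h]
  simp only [Finset.mem_insert, Finset.mem_singleton, exists_eq_or_imp, exists_eq_left,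
    Finset.insert_subset_iff, Finset.singleton_subset_iff]
  tauto

lemma spoke_mem_contour_iff (v : Vertex) (i : Fin 6) :
    s(v, spoke v i) ∈ D.contour ↔ ¬ (sector v (i - 1) ∈ D ↔ sector v i ∈ D) :=
  mem_contour_iff_of_diamond_eq (adj_spoke v i) <| by
    rw [diamond_spoke, Finset.image_insert, Finset.image_singleton]

lemma eq_of_forall_ne_sub_one {n : ℕ} {α : Type*} {f : Fin (n + 1) → α} {i : Fin (n + 1)}
    (h : ∀ j ≠ i, f (j - 1) = f j) (j : Fin (n + 1)) : f j = f i := by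
  suffices ∀ k, f (i + k) = f i by simpa using this (j - i)
  intro k
  induction k using Fin.induction with
  | zero => rw [add_zero]
  | succ k ih =>
    rw [← h (i + k.succ) (by simp [Fin.succ_ne_zero]), ← Fin.coeSucc_eq_succ, ← ih, ← add_assoc,
      add_sub_cancel_right]

lemma exists_ne_mem_contour (he : e ∈ D.contour) (hv : v ∈ e) :
    ∃ e' ∈ D.contour, v ∈ e' ∧ e' ≠ e := by
  obtain ⟨i, rfl⟩ := exists_eq_spoke (mem_edgeSet_of_mem_edges (contour_subset_edges he)) hv
  by_contra! hno
  refine (spoke_mem_contour_iff v i).1 he (iff_of_eq ?_)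
  refine eq_of_forall_ne_sub_one (f := fun j => sector v j ∈ D) (fun j hj => propext ?_) (i - 1)
  by_contra hj'
  have heq := hno _ ((spoke_mem_contour_iff v j).2 hj') (Sym2.mem_mk_left v _)
  exact hj (spoke_injective v (Sym2.congr_right.1 heq))

/-- The vertices of a domain that are not on its contour. -/
def Domain.innerVertices (D : Domain) : Set Vertex := {v | v ∈ D.vertices ∧ v ∉ D.contourVertices}

lemma mem_innerVertices_iff : v ∈ D.innerVertices ↔ hexagon v ⊆ D := by
  constructor
  · rintro ⟨hv, hcontour⟩ t ht
    obtain ⟨t₀, ht₀, hv⟩ := Finset.mem_biUnion.1 hv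
    obtain ⟨i, -, rfl⟩ := Finset.mem_image.1 (mem_hexagon_iff.2 hv)
    obtain ⟨j, -, rfl⟩ := Finset.mem_image.1 ht
    have hstep : ∀ j, (sector v (j - 1) ∈ D) = (sector v j ∈ D) := fun j => propext <|
      not_not.1 fun hj =>
        hcontour ⟨_, (spoke_mem_contour_iff v j).2 hj, Sym2.mem_mk_left v (spoke v j)⟩
    exact (eq_of_forall_ne_sub_one (f := fun j => sector v j ∈ D) (i := i)
      (fun j _ => hstep j) j).mpr ht₀
  · refine fun h => ⟨Finset.mem_biUnion.2 ⟨sector v 0, h ?_, mem_hexagon_iff.1 ?_⟩, ?_⟩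
    · exact Finset.mem_image_of_mem _ (Finset.mem_univ _)
    · exact Finset.mem_image_of_mem _ (Finset.mem_univ _)
    · rintro ⟨e, he, hv⟩
      obtain ⟨hedge, hsub⟩ := mem_contour_iff.1 he
      exact hsub ((diamond_subset_hexagon (mem_edgeSet_of_mem_edges hedge) hv).trans h)

lemma innerVertices_mono (h : D ⊆ E) : D.innerVertices ⊆ E.innerVertices := fun _ hv =>
  mem_innerVertices_iff.2 ((mem_innerVertices_iff.1 hv).trans h)

lemma diamond_subset_of_mem_innerVertices (hv : v ∈ D.innerVertices) (he : e ∈ grid.edgeSet)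
    (hve : v ∈ e) : diamond e ⊆ D :=
  (diamond_subset_hexagon he hve).trans (mem_innerVertices_iff.1 hv)

lemma mem_edges_of_mem_innerVertices (hv : v ∈ D.innerVertices) (he : e ∈ grid.edgeSet)
    (hve : v ∈ e) : e ∈ D.edges :=
  mem_edges_of_diamond_subset he (diamond_subset_of_mem_innerVertices hv he hve)

lemma vertices_induction {p : Vertex → Prop} (contour : ∀ v ∈ D.contourVertices, p v)
    (step : ∀ u v, s(u, v) ∈ D.edges → p u → p v) : ∀ v ∈ D.vertices, p v := by
  classical
  by_contra! hfalse
  -- A rightmost counterexample `v` is not on the contour, so the step to its right stays in `D`.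
  obtain ⟨v, hv, hmax⟩ := (D.vertices.filter (¬ p ·)).exists_max_image Prod.fst
    (by simpa [Finset.Nonempty] using hfalse)
  obtain ⟨hvD, hpv⟩ := Finset.mem_filter.1 hv
  have hinner : v ∈ D.innerVertices := ⟨hvD, fun h => hpv (contour v h)⟩
  have hedge : s(spoke v 0, v) ∈ D.edges :=
    mem_edges_of_mem_innerVertices hinner (adj_spoke v 0).symm (Sym2.mem_mk_right _ v)
  refine hpv (step _ _ hedge (by_contra fun hp => ?_))
  have := hmax _ (Finset.mem_filter.2
    ⟨mem_vertices_of_mem_edges hedge (Sym2.mem_mk_left _ v), hp⟩)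
  simp [spoke] at this

lemma contour_nonempty (h : D.Nonempty) : D.contour.Nonempty := by
  by_contra hempty
  obtain ⟨t, ht⟩ := h
  obtain ⟨u, v, w, -, -, -, hsides⟩ := exists_sides_eq t
  have hedge : s(u, v) ∈ D.edges := Finset.mem_biUnion.2 ⟨t, ht, by simp [hsides]⟩
  exact vertices_induction (p := fun _ => False) (fun _ ⟨e, he, _⟩ => hempty ⟨e, he⟩)
    (fun _ _ _ => id) u (mem_vertices_of_mem_edges hedge (Sym2.mem_mk_left u v))

lemma eq_of_contour_eq (h : D.contour = E.contour) : D = E := by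
  rw [← symmDiff_eq_bot, Finset.bot_eq_empty, ← Finset.not_nonempty_iff_eq_empty]
  intro hne
  obtain ⟨e, he⟩ := contour_nonempty hne
  have hgrid := mem_edgeSet_of_mem_edges (contour_subset_edges he)
  have := Set.ext_iff.1 h e
  rw [mem_contour_iff_of_diamond_eq hgrid rfl] at he
  rw [mem_contour_iff_of_diamond_eq hgrid rfl, mem_contour_iff_of_diamond_eq hgrid rfl] at this
  simp only [Finset.mem_symmDiff] at he
  tauto

end Contours

section Walks

variable {V : Type*} {G H : SimpleGraph V}

lemma iff_of_mem_support {P : V → Prop} {x y z : V} {p : G.Walk x y}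
    (step : ∀ a b, s(a, b) ∈ p.edges → P a → P b) (hz : z ∈ p.support) : P z ↔ P x := by
  induction p with
  | nil => rw [SimpleGraph.Walk.mem_support_nil_iff.1 hz]
  | @cons a b c hab q ih =>
    rw [SimpleGraph.Walk.edges_cons] at step
    rcases List.mem_cons.1 (SimpleGraph.Walk.support_cons hab q ▸ hz) with rfl | hz
    · rfl
    · refine (ih (fun a b h => step a b (List.mem_cons_of_mem _ h)) hz).trans ⟨?_, ?_⟩
      · exact step b a (by rw [Sym2.eq_swap]; exact List.mem_cons_self)
      · exact step a b List.mem_cons_self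

lemma reachable_of_mem_support {x y z : V} {p : G.Walk x y} (hp : ∀ e ∈ p.edges, e ∈ H.edgeSet)
    (hz : z ∈ p.support) : H.Reachable x z :=
  (iff_of_mem_support (P := H.Reachable x)
    (fun _ _ hab hxa => hxa.trans (SimpleGraph.Adj.reachable (hp _ hab))) hz).2
    (SimpleGraph.Reachable.refl x)

lemma exists_reachable_of_descent {α : Type*} [Preorder α] {f : V → α} {S : Set V}
    (hS : S.Finite) {P : V → Prop}
    (hstep : ∀ x ∈ S, ¬ P x → ∃ y ∈ S, H.Adj x y ∧ f y < f x) {x : V} (hx : x ∈ S) :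
    ∃ y, P y ∧ H.Reachable x y := by
  obtain ⟨m, ⟨hmS, hxm⟩, hmin⟩ := (hS.subset fun _ h => h.1).exists_minimalFor f
    {y | y ∈ S ∧ H.Reachable x y} ⟨x, hx, SimpleGraph.Reachable.refl x⟩
  refine ⟨m, by_contra fun hm => ?_, hxm⟩
  obtain ⟨y, hyS, hmy, hlt⟩ := hstep m hmS hm
  exact hlt.not_ge (hmin ⟨hyS, hxm.trans hmy.reachable⟩ hlt.le)

lemma eq_or_eq_of_isCycle {x v a b c : V} {C : G.Walk x x} (hC : C.IsCycle) (hab : a ≠ b)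
    (ha : s(v, a) ∈ C.edges) (hb : s(v, b) ∈ C.edges) (hc : s(v, c) ∈ C.edges) :
    c = a ∨ c = b := by
  have hcard := hC.ncard_neighborSet_toSubgraph_eq_two (C.fst_mem_support_of_mem_edges ha)
  have hsub : {a, b} ⊆ C.toSubgraph.neighborSet v := by
    rintro w (rfl | rfl)
    exacts [C.mem_edges_toSubgraph.2 ha, C.mem_edges_toSubgraph.2 hb]
  have heq : {a, b} = C.toSubgraph.neighborSet v :=
    Set.eq_of_subset_of_ncard_le hsub (by rw [hcard, Set.ncard_pair hab])
      (Set.finite_of_ncard_ne_zero (by rw [hcard]; exact two_ne_zero))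
  exact heq.symm.subset (C.mem_edges_toSubgraph.2 hc)

lemma edges_subset_of_forall_exists_ne {S : Set (Sym2 V)} (hne : S.Nonempty)
    (hS : ∀ e ∈ S, ∀ v ∈ e, ∃ e' ∈ S, v ∈ e' ∧ e' ≠ e) {x : V} {C : G.Walk x x} (hC : C.IsCycle)
    (hSC : ∀ e ∈ S, e ∈ C.edges) : ∀ e ∈ C.edges, e ∈ S := by
  have saturated : ∀ e₀ ∈ S, ∀ v ∈ e₀, ∀ e ∈ C.edges, v ∈ e → e ∈ S := by
    rintro e₀ he₀ v hv _ he ⟨c, rfl⟩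
    obtain ⟨e₁, he₁, ⟨b, rfl⟩, hne⟩ := hS e₀ he₀ v hv
    obtain ⟨a, rfl⟩ := hv
    have hba : b ≠ a := fun h => hne (h ▸ rfl)
    rcases eq_or_eq_of_isCycle hC hba (hSC _ he₁) (hSC _ he₀) he with rfl | rfl
    exacts [he₁, he₀]
  have spread : ∀ a b, s(a, b) ∈ C.edges →
      (∀ e ∈ C.edges, a ∈ e → e ∈ S) → ∀ e ∈ C.edges, b ∈ e → e ∈ S :=
    fun a b hab ha => saturated _ (ha _ hab (Sym2.mem_mk_left a b)) b (Sym2.mem_mk_right a b)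
  obtain ⟨⟨a₀, b₀⟩, he₀⟩ := hne
  have ha₀ := C.fst_mem_support_of_mem_edges (hSC _ he₀)
  rintro ⟨a, b⟩ he
  exact (iff_of_mem_support spread (C.fst_mem_support_of_mem_edges he)).2
    ((iff_of_mem_support spread ha₀).1 (saturated _ he₀ a₀ (Sym2.mem_mk_left a₀ b₀)))
    _ he (Sym2.mem_mk_left a b)

end Walks

section DelimitedDomains

variable {F : Domain} {v : Vertex} {C : grid.Walk v v}

lemma IsDelimitedBy.mem_contour_iff (h : IsDelimitedBy F C) {e : Sym2 Vertex} :
    e ∈ F.contour ↔ e ∈ C.edges := by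
  rw [h, Set.mem_ofPred_eq]

lemma IsDelimitedBy.mem_support (h : IsDelimitedBy F C) {x : Vertex}
    (hx : x ∈ F.contourVertices) : x ∈ C.support := by
  obtain ⟨e, he, hxe⟩ := hx
  exact SimpleGraph.Walk.mem_support_of_mem_edges (h.mem_contour_iff.1 he) hxe

lemma IsDelimitedBy.isCycle (h : IsDelimitedBy F C) (hF : F.Nonempty) (hC : C.Nil ∨ C.IsCycle) :
    C.IsCycle := by
  refine hC.resolve_left fun hnil => ?_
  obtain ⟨e, he⟩ := contour_nonempty hF
  rw [h.mem_contour_iff, SimpleGraph.Walk.edges_eq_nil.2 hnil] at he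
  exact List.not_mem_nil he

lemma IsDelimitedBy.eq_of_contour_subset (h : IsDelimitedBy F C) (hC : C.IsCycle) {A : Domain}
    (hA : A.Nonempty) (hAF : A.contour ⊆ F.contour) : A = F := by
  refine eq_of_contour_eq (hAF.antisymm fun e he => ?_)
  exact edges_subset_of_forall_exists_ne (contour_nonempty hA)
    (fun _ he _ hv => exists_ne_mem_contour he hv) hC
    (fun _ he => h.mem_contour_iff.1 (hAF he)) e (h.mem_contour_iff.1 he)

lemma contour_subset_of_forall_adj {A : Domain} (hAF : A ⊆ F)
    (hA : ∀ t ∈ A, ∀ t' ∈ F, Triangle.adjacency.Adj t t' → t' ∈ A) : A.contour ⊆ F.contour := by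
  intro e he
  have hgrid := mem_edgeSet_of_mem_edges (contour_subset_edges he)
  have hadj := adj_upper_lower hgrid
  rw [mem_contour_iff_of_diamond_eq hgrid rfl] at he ⊢
  have hupper := hA (upper e)
  have hlower := hA (lower e)
  have := @hAF (upper e)
  have := @hAF (lower e)
  have := hadj.symm
  tauto

lemma IsDelimitedBy.isConnected (h : IsDelimitedBy F C) (hC : C.IsCycle) (hF : F.Nonempty) :
    F.IsConnected := by
  classical
  rw [Domain.IsConnected, SimpleGraph.connected_iff]
  refine ⟨?_, hF.to_subtype⟩
  rintro ⟨t, ht⟩ ⟨t', ht'⟩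
  set K := Triangle.adjacency.induce (F : Set Triangle)
  let A : Domain :=
    F.filter fun a => ∃ ha : a ∈ (F : Set Triangle), K.Reachable ⟨t, ht⟩ ⟨a, ha⟩
  have hclosed : ∀ a ∈ A, ∀ a' ∈ F, Triangle.adjacency.Adj a a' → a' ∈ A := by
    intro a ha a' ha' hadj
    obtain ⟨-, haF, hr⟩ := Finset.mem_filter.1 ha
    have hadj' : K.Adj ⟨a, haF⟩ ⟨a', ha'⟩ := hadj
    exact Finset.mem_filter.2 ⟨ha', ha', hr.trans hadj'.reachable⟩
  have htA : t ∈ A := Finset.mem_filter.2 ⟨ht, ht, SimpleGraph.Reachable.refl _⟩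
  have hAF : A = F := h.eq_of_contour_subset hC ⟨t, htA⟩
    (contour_subset_of_forall_adj (Finset.filter_subset _ _) hclosed)
  rw [Finset.mem_coe, ← hAF] at ht'
  exact (Finset.mem_filter.1 ht').2.2

end DelimitedDomains

section Tilings

variable {D : Domain} {T : Finset Domain} {e e' : Sym2 Vertex}

lemma IsTiling.subset (hT : IsTiling D T) {l : Domain} (hl : l ∈ T) : l ⊆ D := by
  rw [← hT.2.2]
  exact Finset.subset_biUnion_of_mem id hl

lemma IsTiling.exists_mem_diamond (hT : IsTiling D T) {t : Triangle} (ht : t ∈ D) :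
    ∃ e ∈ grid.edgeSet, diamond e ∈ T ∧ t ∈ diamond e := by
  rw [← hT.2.2] at ht
  obtain ⟨l, hl, htl⟩ := Finset.mem_biUnion.1 ht
  obtain ⟨e, he, rfl⟩ := isLozenge_iff_exists_diamond.1 (hT.1 l hl)
  exact ⟨e, he, hl, htl⟩

lemma IsTiling.eq_of_mem (hT : IsTiling D T) {l l' : Domain} (hl : l ∈ T) (hl' : l' ∈ T)
    {t : Triangle} (ht : t ∈ l) (ht' : t ∈ l') : l = l' :=
  hT.2.1.eq hl hl' (Finset.not_disjoint_iff.2 ⟨t, ht, ht'⟩)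

lemma IsTiling.cutsTile_iff (hT : IsTiling D T) (he : e ∈ grid.edgeSet) :
    CutsTile T e ↔ diamond e ∈ T := by
  constructor
  · rintro ⟨l, hl, hcut⟩
    obtain ⟨t, t', hadj, rfl⟩ := hT.1 l hl
    rwa [diamond_eq_pair hadj.ne (hcut t (by simp)) (hcut t' (by simp))]
  · exact fun hl => ⟨_, hl, fun t ht => (mem_diamond_iff he).1 ht⟩

lemma IsTiling.diamond_notMem (hT : IsTiling D T) (hl : diamond e ∈ T) {t : Triangle}
    (he : e ∈ t.sides) (he' : e' ∈ t.sides) (hne : e' ≠ e) : diamond e' ∉ T := by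
  have hgrid := mem_edgeSet_of_mem_sides he
  have hgrid' := mem_edgeSet_of_mem_sides he'
  intro hl'
  exact hne (diamond_injOn hgrid' hgrid
    (hT.eq_of_mem hl' hl ((mem_diamond_iff hgrid').2 he') ((mem_diamond_iff hgrid).2 he)))

lemma IsTiling.isTileable_of_subset {F : Domain} (hT : IsTiling D T) (hFD : F ⊆ D)
    (hF : ∀ e ∈ F.contour, diamond e ∉ T) : IsTileable F := by
  classical
  refine ⟨T.filter (· ⊆ F), fun l hl => hT.1 l (Finset.mem_filter.1 hl).1,
    hT.2.1.subset fun l hl => (Finset.mem_filter.1 hl).1, ?_⟩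
  ext t
  simp only [Finset.mem_biUnion, Finset.mem_filter, id]
  constructor
  · rintro ⟨l, ⟨-, hl⟩, ht⟩
    exact hl ht
  · intro ht
    obtain ⟨e, he, hl, hte⟩ := hT.exists_mem_diamond (hFD ht)
    refine ⟨diamond e, ⟨hl, by_contra fun hsub => hF e ?_ hl⟩, hte⟩
    exact mem_contour_iff.2 ⟨(mem_edges_iff he).2 ⟨t, hte, ht⟩, hsub⟩

end Tilings

section Heights

variable {D : Domain} {T T' T'' : Finset Domain} {h h' h'' k k' : Vertex → ℤ} {u v w : Vertex}

lemma IsHeight.eq_add_one (hh : IsHeight D T h) (hT : IsTiling D T) (huv : PosStep u v)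
    (he : s(u, v) ∈ D.edges) (hl : diamond s(u, v) ∉ T) : h v = h u + 1 :=
  hh u v huv he fun hcut => hl ((hT.cutsTile_iff huv.adj).1 hcut)

lemma IsHeight.eq_add_one_of_mem_sides (hh : IsHeight D T h) (hT : IsTiling D T)
    {e : Sym2 Vertex} (hl : diamond e ∈ T) {t : Triangle} (he : e ∈ t.sides)
    (huv : PosStep u v) (hside : s(u, v) ∈ t.sides) (hne : s(u, v) ≠ e) : h v = h u + 1 := by
  have htD : t ∈ D := hT.subset hl ((mem_diamond_iff (mem_edgeSet_of_mem_sides he)).2 he)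
  exact hh.eq_add_one hT huv (Finset.mem_biUnion.2 ⟨t, htD, hside⟩)
    (hT.diamond_notMem hl he hside hne)

lemma IsHeight.eq_sub_two (hh : IsHeight D T h) (hT : IsTiling D T) (huv : PosStep u v)
    (hl : diamond s(u, v) ∈ T) : h v = h u - 2 := by
  have hside := (mem_diamond_iff huv.adj).1 (upper_mem_diamond s(u, v))
  obtain ⟨w, hvw, hwu, hsides⟩ := exists_sides_eq_of_posStep huv hside
  have hw : h w = h v + 1 :=
    hh.eq_add_one_of_mem_sides hT hl hside hvw (by simp [hsides]) (by simp [huv.ne.symm, hwu.ne])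
  have hu : h u = h w + 1 :=
    hh.eq_add_one_of_mem_sides hT hl hside hwu (by simp [hsides]) (by simp [hvw.ne.symm, hwu.ne])
  omega

lemma IsHeight.sub_eq_ite (hh : IsHeight D T h) (hT : IsTiling D T) (huv : PosStep u v)
    (he : s(u, v) ∈ D.edges) : h v - h u = if diamond s(u, v) ∈ T then -2 else 1 := by
  split_ifs with hl
  · rw [hh.eq_sub_two hT huv hl]
    ring
  · rw [hh.eq_add_one hT huv he hl]
    ring

lemma IsHeight.le_add_one (hh : IsHeight D T h) (hT : IsTiling D T) (huv : PosStep u v)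
    (he : s(u, v) ∈ D.edges) : h v ≤ h u + 1 := by
  have := hh.sub_eq_ite hT huv he
  split_ifs at this <;> omega

lemma IsHeight.abs_sub_eq_one_iff (hh : IsHeight D T h) (hT : IsTiling D T)
    (he : s(u, v) ∈ D.edges) : |h v - h u| = 1 ↔ diamond s(u, v) ∉ T := by
  rcases (mem_edgeSet_of_mem_edges he).2 with huv | hvu
  · rw [hh.sub_eq_ite hT huv he]
    split_ifs with hl <;> simp [hl]
  · rw [Sym2.eq_swap] at he ⊢
    rw [abs_sub_comm, hh.sub_eq_ite hT hvu he]
    split_ifs with hl <;> simp [hl]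

lemma IsHeight.sub_eq_sub (hh : IsHeight D T h) (hh' : IsHeight D T h') (hT : IsTiling D T)
    (he : s(u, v) ∈ D.edges) : h v - h u = h' v - h' u := by
  rcases (mem_edgeSet_of_mem_edges he).2 with huv | hvu
  · rw [hh.sub_eq_ite hT huv he, hh'.sub_eq_ite hT huv he]
  · rw [Sym2.eq_swap] at he
    have hsub : h u - h v = h' u - h' v :=
      (hh.sub_eq_ite hT hvu he).trans (hh'.sub_eq_ite hT hvu he).symm
    omega

lemma AreNormalizedHeights.symm (hh : AreNormalizedHeights D T T' h h') :
    AreNormalizedHeights D T' T h' h :=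
  ⟨hh.2.1, hh.1, fun v hv => (hh.2.2 v hv).symm⟩

lemma AreNormalizedHeights.trans (hh : AreNormalizedHeights D T T' h h')
    (hh' : AreNormalizedHeights D T' T'' h' h'') : AreNormalizedHeights D T T'' h h'' :=
  ⟨hh.1, hh'.2.1, fun v hv => (hh.2.2 v hv).trans (hh'.2.2 v hv)⟩

lemma AreNormalizedHeights.sub_eq_sub (hT : IsTiling D T) (hT' : IsTiling D T')
    (hh : AreNormalizedHeights D T T' h h') (hk : AreNormalizedHeights D T T' k k') :
    ∀ v ∈ D.vertices, h' v - h v = k' v - k v := by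
  refine vertices_induction (fun v hv => ?_) fun u v he hu => ?_
  · rw [hh.2.2 v hv, hk.2.2 v hv, sub_self, sub_self]
  · have := hh.1.sub_eq_sub hk.1 hT he
    have := hh.2.1.sub_eq_sub hk.2.1 hT' he
    omega

lemma HasConsistentHeights.exists_normalized (hD : HasConsistentHeights D) (hT : IsTiling D T)
    (hT' : IsTiling D T') (hh : IsHeight D T h) : ∃ h', AreNormalizedHeights D T T' h h' := by
  obtain ⟨k, k', hk, hk', heq⟩ := hD T T' hT hT'
  refine ⟨fun v => k' v - k v + h v, hh, fun u v huv he hcut => ?_, fun v hv => ?_⟩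
  · have := hk' u v huv he hcut
    have := hk.sub_eq_sub hh hT he
    dsimp only
    omega
  · dsimp only
    rw [heq v hv, sub_self, zero_add]

lemma TilingLE.le (hle : TilingLE D T T') (hT : IsTiling D T) (hT' : IsTiling D T')
    (hh : AreNormalizedHeights D T T' h h') : ∀ v ∈ D.vertices, h v ≤ h' v := by
  obtain ⟨k, k', hk, hkle⟩ := hle
  intro v hv
  have := hh.sub_eq_sub hT hT' hk v hv
  have := hkle v hv
  omega

lemma IsSolid.eq (hv : IsSolid D v) (hD : HasConsistentHeights D) (hT : IsTiling D T)
    (hT' : IsTiling D T') (hh : AreNormalizedHeights D T T' h h') : h v = h' v := by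
  obtain ⟨hvD, A, B, a, b, hA, hB, hab, heq⟩ := hv
  have eq_min : ∀ {T h}, IsTiling D T → AreNormalizedHeights D A T a h → a v = h v := by
    intro T h hT hah
    have := (hA.2 T hT).le hA.1 hT hah v hvD
    have := (hB.2 T hT).le hT hB.1 (hah.symm.trans hab) v hvD
    omega
  obtain ⟨k, hk⟩ := hD.exists_normalized hA.1 hT hab.1
  obtain ⟨k', hk'⟩ := hD.exists_normalized hA.1 hT' hab.1
  have := eq_min hT hk
  have := eq_min hT' hk'
  have := hh.sub_eq_sub hT hT' (hk.symm.trans hk') v hvD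
  omega

lemma IsSolid.sub_eq_sub (hu : IsSolid D u) (hv : IsSolid D v) (hD : HasConsistentHeights D)
    (he : s(u, v) ∈ D.edges) (hT : IsTiling D T) (hT' : IsTiling D T') (hh : IsHeight D T h)
    (hh' : IsHeight D T' h') : h v - h u = h' v - h' u := by
  obtain ⟨k, hk⟩ := hD.exists_normalized hT hT' hh
  rw [hu.eq hD hT hT' hk, hv.eq hD hT hT' hk, hk.2.1.sub_eq_sub hh' hT' he]

end Heights

section Flips

variable {D E : Domain} {T A B : Finset Domain} {h : Vertex → ℤ} {u v w : Vertex}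

lemma IsTiling.exchange (hT : IsTiling D T) (hAT : A ⊆ T) (hA : IsTiling E A)
    (hB : IsTiling E B) : IsTiling D (T \ A ∪ B) := by
  have hdisj : ∀ l ∈ T \ A, ∀ l' ∈ B, Disjoint l l' := by
    intro l hl l' hl'
    obtain ⟨hlT, hlA⟩ := Finset.mem_sdiff.1 hl
    refine Finset.disjoint_left.2 fun t ht ht' => ?_
    have htE := hB.subset hl' ht'
    rw [← hA.2.2] at htE
    obtain ⟨m, hm, htm⟩ := Finset.mem_biUnion.1 htE
    exact hlA (hT.eq_of_mem hlT (hAT hm) ht htm ▸ hm)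
  refine ⟨?_, ?_, ?_⟩
  · intro l hl
    rcases Finset.mem_union.1 hl with hl | hl
    exacts [hT.1 l (Finset.mem_sdiff.1 hl).1, hB.1 l hl]
  · rw [Finset.coe_union, Set.pairwiseDisjoint_union]
    exact ⟨hT.2.1.subset (Finset.coe_subset.2 Finset.sdiff_subset), hB.2.1,
      fun l hl l' hl' _ => hdisj l hl l' hl'⟩
  · rw [Finset.union_biUnion, hB.2.2, ← hA.2.2, ← Finset.union_biUnion,
      Finset.sdiff_union_of_subset hAT, hT.2.2]

lemma eq_of_diamond_eq {u' v' : Vertex} (huv : PosStep u v) (huv' : PosStep u' v')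
    (h : diamond s(u, v) = diamond s(u', v')) : u = u' ∧ v = v' := by
  refine (Sym2.eq_iff.1 (diamond_injOn huv.adj huv'.adj h)).resolve_right ?_
  rintro ⟨rfl, rfl⟩
  exact huv.asymm huv'

/-- Three lozenges that tile the hexagon around `v`, cut by every other spoke. In `petals v 0` they
are cut by the positively directed edges that start at `v`, in `petals v 1` by those that end
at `v`; a flip at `v` exchanges these two tilings of the hexagon. -/
def petals (v : Vertex) (i : Fin 6) : Finset Domain :=
  ({i, i + 2, i + 4} : Finset (Fin 6)).image fun j => diamond s(v, spoke v j)

lemma isTiling_petals (v : Vertex) (i : Fin 6) : IsTiling (hexagon v) (petals v i) := by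
  refine ⟨?_, ?_, ?_⟩
  · intro l hl
    obtain ⟨j, -, rfl⟩ := Finset.mem_image.1 hl
    exact isLozenge_iff_exists_diamond.2 ⟨_, adj_spoke v j, rfl⟩
  · have hdisj : ∀ i : Fin 6, ∀ j ∈ ({i, i + 2, i + 4} : Finset (Fin 6)),
        ∀ k ∈ ({i, i + 2, i + 4} : Finset (Fin 6)), j ≠ k →
          Disjoint ({j - 1, j} : Finset (Fin 6)) {k - 1, k} := by decide
    rw [petals, Finset.coe_image]
    rintro _ ⟨j, hj, rfl⟩ _ ⟨k, hk, rfl⟩ hne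
    simp only [Function.onFun, id, diamond_spoke]
    exact (Finset.disjoint_image (sector_injective v)).2
      (hdisj i j hj k hk fun hjk => hne (hjk ▸ rfl))
  · have hunion : ∀ i : Fin 6, ({i, i + 2, i + 4} : Finset (Fin 6)).biUnion
        (fun j => ({j - 1, j} : Finset (Fin 6))) = Finset.univ := by decide
    simp only [petals, hexagon, Finset.image_biUnion, id, diamond_spoke, ← hunion i,
      Finset.biUnion_image]

lemma diamond_mem_petals_zero_iff (huw : PosStep u w) :
    diamond s(u, w) ∈ petals v 0 ↔ u = v := by
  have hpetals : diamond s(u, w) ∈ petals v 0 ↔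
      ∃ w', PosStep v w' ∧ diamond s(u, w) = diamond s(v, w') := by
    simp [petals, posStep_iff_spoke_even]
  rw [hpetals]
  constructor
  · rintro ⟨w', hvw', heq⟩
    exact (eq_of_diamond_eq huw hvw' heq).1
  · rintro rfl
    exact ⟨w, huw, rfl⟩

lemma diamond_mem_petals_one_iff (huw : PosStep u w) :
    diamond s(u, w) ∈ petals v 1 ↔ w = v := by
  have hpetals : diamond s(u, w) ∈ petals v 1 ↔
      ∃ u', PosStep u' v ∧ diamond s(u, w) = diamond s(u', v) := by
    simp [petals, posStep_iff_spoke_odd, Sym2.eq_swap (b := v)]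
  rw [hpetals]
  constructor
  · rintro ⟨u', hu'v, heq⟩
    exact (eq_of_diamond_eq huw hu'v heq).2
  · rintro rfl
    exact ⟨u, huw, rfl⟩

lemma IsHeight.exchange {h' : Vertex → ℤ} (hh : IsHeight D T h) (hT : IsTiling D T)
    (hT' : IsTiling D (T \ A ∪ B))
    (hA : ∀ u v, PosStep u v → diamond s(u, v) ∈ A → h' v = h' u + 1)
    (hAB : ∀ u v, PosStep u v → diamond s(u, v) ∉ A → diamond s(u, v) ∉ B →
      h' v - h' u = h v - h u) : IsHeight D (T \ A ∪ B) h' := by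
  intro u v huv he hcut
  rw [hT'.cutsTile_iff huv.adj, Finset.mem_union, Finset.mem_sdiff] at hcut
  push Not at hcut
  by_cases hl : diamond s(u, v) ∈ A
  · exact hA u v huv hl
  · have := hh.eq_add_one hT huv he fun hlT => hl (hcut.1 hlT)
    have := hAB u v huv hl hcut.2
    omega

lemma IsMaximalTiling.exists_posStep_to (hT : IsMaximalTiling D T) (hh : IsHeight D T h)
    (hv : v ∈ D.innerVertices) : ∃ u, PosStep u v ∧ h v = h u + 1 := by
  by_contra! hno
  have hcut : ∀ u, PosStep u v → diamond s(u, v) ∈ T := fun u huv => by_contra fun hl =>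
    hno u huv (hh.eq_add_one hT.1 huv
      (mem_edges_of_mem_innerVertices hv huv.adj (Sym2.mem_mk_right u v)) hl)
  have hsub : petals v 1 ⊆ T := by
    intro l hl
    obtain ⟨e, he, rfl⟩ := isLozenge_iff_exists_diamond.1 ((isTiling_petals v 1).1 l hl)
    obtain ⟨u, w, huw, rfl⟩ := exists_posStep_of_mem_edgeSet he
    obtain rfl := (diamond_mem_petals_one_iff huw).1 hl
    exact hcut u huw
  have hT' := hT.1.exchange hsub (isTiling_petals v 1) (isTiling_petals v 0)
  have hh' : IsHeight D (T \ petals v 1 ∪ petals v 0) (Function.update h v (h v + 3)) := by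
    refine hh.exchange hT.1 hT' (fun u w huw hl => ?_) fun u w huw hin hout => ?_
    · obtain rfl := (diamond_mem_petals_one_iff huw).1 hl
      rw [Function.update_self, Function.update_of_ne huw.ne, hh.eq_sub_two hT.1 huw (hcut u huw)]
      ring
    · rw [diamond_mem_petals_one_iff huw] at hin
      rw [diamond_mem_petals_zero_iff huw] at hout
      rw [Function.update_of_ne hin, Function.update_of_ne hout]
  have hle := (hT.2 _ hT').le hT' hT.1 ⟨hh', hh, fun x hx =>
    Function.update_of_ne (ne_of_mem_of_not_mem hx hv.2) _ _⟩ v hv.1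
  rw [Function.update_self] at hle
  omega

lemma IsMinimalTiling.exists_posStep_from (hT : IsMinimalTiling D T) (hh : IsHeight D T h)
    (hv : v ∈ D.innerVertices) : ∃ w, PosStep v w ∧ h w = h v + 1 := by
  by_contra! hno
  have hcut : ∀ w, PosStep v w → diamond s(v, w) ∈ T := fun w hvw => by_contra fun hl =>
    hno w hvw (hh.eq_add_one hT.1 hvw
      (mem_edges_of_mem_innerVertices hv hvw.adj (Sym2.mem_mk_left v w)) hl)
  have hsub : petals v 0 ⊆ T := by
    intro l hl
    obtain ⟨e, he, rfl⟩ := isLozenge_iff_exists_diamond.1 ((isTiling_petals v 0).1 l hl)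
    obtain ⟨u, w, huw, rfl⟩ := exists_posStep_of_mem_edgeSet he
    obtain rfl := (diamond_mem_petals_zero_iff huw).1 hl
    exact hcut w huw
  have hT' := hT.1.exchange hsub (isTiling_petals v 0) (isTiling_petals v 1)
  have hh' : IsHeight D (T \ petals v 0 ∪ petals v 1) (Function.update h v (h v - 3)) := by
    refine hh.exchange hT.1 hT' (fun u w huw hl => ?_) fun u w huw hout hin => ?_
    · obtain rfl := (diamond_mem_petals_zero_iff huw).1 hl
      rw [Function.update_self, Function.update_of_ne huw.ne.symm,
        hh.eq_sub_two hT.1 huw (hcut w huw)]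
      ring
    · rw [diamond_mem_petals_one_iff huw] at hin
      rw [diamond_mem_petals_zero_iff huw] at hout
      rw [Function.update_of_ne hin, Function.update_of_ne hout]
  have hle := (hT.2 _ hT').le hT.1 hT' ⟨hh, hh', fun x hx =>
    (Function.update_of_ne (ne_of_mem_of_not_mem hx hv.2) _ _).symm⟩ v hv.1
  rw [Function.update_self] at hle
  omega

end Flips

section SolidVertices

/-- A minimal tiling `A` and a maximal tiling `B` of `D`, with height functions `a` and `b` that
agree on the contour; these witness which vertices of `D` are solid. -/
structure IsExtremalPair (D : Domain) (A B : Finset Domain) (a b : Vertex → ℤ) : Prop where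
  minimal : IsMinimalTiling D A
  maximal : IsMaximalTiling D B
  heights : AreNormalizedHeights D A B a b

variable {D : Domain} {A B : Finset Domain} {a b : Vertex → ℤ} {u v : Vertex}

lemma IsSolid.exists_isExtremalPair (hv : IsSolid D v) : ∃ A B a b, IsExtremalPair D A B a b := by
  obtain ⟨-, A, B, a, b, hA, hB, hab, -⟩ := hv
  exact ⟨A, B, a, b, hA, hB, hab⟩

namespace IsExtremalPair

lemma le (hx : IsExtremalPair D A B a b) (hv : v ∈ D.vertices) : a v ≤ b v :=
  (hx.minimal.2 B hx.maximal.1).le hx.minimal.1 hx.maximal.1 hx.heights v hv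

lemma eq (hx : IsExtremalPair D A B a b) (hD : HasConsistentHeights D) (hv : IsSolid D v) :
    a v = b v :=
  hv.eq hD hx.minimal.1 hx.maximal.1 hx.heights

lemma isSolid (hx : IsExtremalPair D A B a b) (hv : v ∈ D.vertices) (hab : a v = b v) :
    IsSolid D v :=
  ⟨hv, A, B, a, b, hx.minimal, hx.maximal, hx.heights, hab⟩

lemma exists_isSolid_posStep_to (hx : IsExtremalPair D A B a b) (hD : HasConsistentHeights D)
    (hvD : v ∈ D.innerVertices) (hv : IsSolid D v) :
    ∃ u, PosStep u v ∧ IsSolid D u ∧ b v = b u + 1 := by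
  obtain ⟨u, huv, hb⟩ := hx.maximal.exists_posStep_to hx.heights.2.1 hvD
  have he := mem_edges_of_mem_innerVertices hvD huv.adj (Sym2.mem_mk_right u v)
  have hu := mem_vertices_of_mem_edges he (Sym2.mem_mk_left u v)
  have ha := hx.heights.1.le_add_one hx.minimal.1 huv he
  have hle := hx.le hu
  have heq := hx.eq hD hv
  exact ⟨u, huv, hx.isSolid hu (by omega), hb⟩

lemma exists_isSolid_posStep_from (hx : IsExtremalPair D A B a b) (hD : HasConsistentHeights D)
    (hvD : v ∈ D.innerVertices) (hv : IsSolid D v) :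
    ∃ w, PosStep v w ∧ IsSolid D w ∧ b w = b v + 1 := by
  obtain ⟨w, hvw, ha⟩ := hx.minimal.exists_posStep_from hx.heights.1 hvD
  have he := mem_edges_of_mem_innerVertices hvD hvw.adj (Sym2.mem_mk_left v w)
  have hw := mem_vertices_of_mem_edges he (Sym2.mem_mk_right v w)
  have hb := hx.heights.2.1.le_add_one hx.maximal.1 hvw he
  have hle := hx.le hw
  have heq := hx.eq hD hv
  exact ⟨w, hvw, hx.isSolid hw (by omega), by omega⟩

end IsExtremalPair

end SolidVertices

section FractureGraph

/-- The graph whose cycles are the fracture lines in `F`: its edges are the edges of `F` with solid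
ends along which the height `h` of some fixed tiling of `D` varies by `1`. -/
def fractureGraph (D F : Domain) (h : Vertex → ℤ) : SimpleGraph Vertex where
  Adj u v := s(u, v) ∈ F.edges ∧ IsSolid D u ∧ IsSolid D v ∧ |h v - h u| = 1
  symm := ⟨fun _ _ ⟨he, hu, hv, hh⟩ =>
    ⟨Sym2.eq_swap ▸ he, hv, hu, (abs_sub_comm _ _).trans hh⟩⟩
  loopless := ⟨fun _ ⟨_, _, _, hh⟩ => by simp at hh⟩

variable {D F : Domain} {T A B : Finset Domain} {h a b : Vertex → ℤ} {u v w : Vertex}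

lemma fractureGraph_le : fractureGraph D F h ≤ grid :=
  fun _ _ huv => mem_edgeSet_of_mem_edges huv.1

lemma fractureGraph_adj_of_eq_add_one (he : s(u, v) ∈ F.edges) (hu : IsSolid D u)
    (hv : IsSolid D v) (hh : h v = h u + 1) : (fractureGraph D F h).Adj u v :=
  ⟨he, hu, hv, by simp [hh]⟩

lemma isSolid_of_mem_fractureGraph_edgeSet {e : Sym2 Vertex}
    (he : e ∈ (fractureGraph D F h).edgeSet) (hv : v ∈ e) : IsSolid D v := by
  obtain ⟨u, rfl⟩ := hv
  exact he.2.1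

lemma isFractureLine_of_isCycle (hFD : F ⊆ D) (hT : IsTiling D T) (hh : IsHeight D T h)
    {C : grid.Walk v v} (hC : C.IsCycle)
    (hCh : ∀ e ∈ C.edges, e ∈ (fractureGraph D F h).edgeSet) :
    IsFractureLine D C ∧ LiesIn C F := by
  have hCF : ∀ e ∈ C.edges, e ∈ F.edges := by
    rintro ⟨x, y⟩ he
    exact (hCh _ he).1
  have hsupport : ∀ x ∈ C.support, ∃ e ∈ C.edges, x ∈ e := fun x =>
    (SimpleGraph.Walk.mem_support_iff_exists_mem_edges_of_not_nil hC.not_nil).1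
  obtain ⟨e, he, hve⟩ := hsupport v C.start_mem_support
  have hv := mem_vertices_of_mem_edges (hCF e he) hve
  refine ⟨⟨⟨T, hT, ⟨Domain.vertices_mono hFD hv, fun e he => Domain.edges_mono hFD (hCF e he)⟩,
    .inr hC, h, hh, fun d hd => ?_⟩, fun x hx => ?_⟩, hv, hCF⟩
  · exact (hCh _ (List.mem_map_of_mem hd)).2.2.2
  · obtain ⟨e, he, hxe⟩ := hsupport x hx
    exact isSolid_of_mem_fractureGraph_edgeSet (hCh e he) hxe

lemma IsExtremalPair.exists_reachable_below (hx : IsExtremalPair D A B a b)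
    (hD : HasConsistentHeights D) (hFD : F ⊆ D) {e : Sym2 Vertex} (hve : v ∈ e)
    (huF : u ∈ F.vertices) (hu : IsSolid D u) (huv : b u < b v) :
    ∃ y ∈ F.contourVertices, ((fractureGraph D F b).deleteEdges {e}).Reachable u y := by
  refine exists_reachable_of_descent (f := b) (S := {x | x ∈ F.vertices ∧ IsSolid D x ∧ b x ≤ b u})
    (F.vertices.finite_toSet.subset fun x hxS => hxS.1) ?_ ⟨huF, hu, le_rfl⟩
  rintro x ⟨hxF, hxs, hxu⟩ hxc
  obtain ⟨y, hyx, hy, hb⟩ :=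
    hx.exists_isSolid_posStep_to hD (innerVertices_mono hFD ⟨hxF, hxc⟩) hxs
  have he := mem_edges_of_mem_innerVertices ⟨hxF, hxc⟩ hyx.adj (Sym2.mem_mk_right y x)
  have hadj : ((fractureGraph D F b).deleteEdges {e}).Adj x y := by
    refine SimpleGraph.deleteEdges_adj.2
      ⟨(fractureGraph_adj_of_eq_add_one he hy hxs hb).symm, ?_⟩
    rintro rfl
    rcases Sym2.mem_iff.1 hve with rfl | rfl <;> omega
  exact ⟨y, ⟨mem_vertices_of_mem_edges he (Sym2.mem_mk_left y x), hy, by omega⟩, hadj, by omega⟩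

lemma IsExtremalPair.exists_reachable_above (hx : IsExtremalPair D A B a b)
    (hD : HasConsistentHeights D) (hFD : F ⊆ D) {e : Sym2 Vertex} (hue : u ∈ e)
    (hvF : v ∈ F.vertices) (hv : IsSolid D v) (huv : b u < b v) :
    ∃ y ∈ F.contourVertices, ((fractureGraph D F b).deleteEdges {e}).Reachable v y := by
  refine exists_reachable_of_descent (f := OrderDual.toDual ∘ b)
    (S := {x | x ∈ F.vertices ∧ IsSolid D x ∧ b v ≤ b x})
    (F.vertices.finite_toSet.subset fun x hxS => hxS.1) ?_ ⟨hvF, hv, le_rfl⟩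
  rintro x ⟨hxF, hxs, hvx⟩ hxc
  obtain ⟨y, hxy, hy, hb⟩ :=
    hx.exists_isSolid_posStep_from hD (innerVertices_mono hFD ⟨hxF, hxc⟩) hxs
  have he := mem_edges_of_mem_innerVertices ⟨hxF, hxc⟩ hxy.adj (Sym2.mem_mk_left x y)
  have hadj : ((fractureGraph D F b).deleteEdges {e}).Adj x y := by
    refine SimpleGraph.deleteEdges_adj.2 ⟨fractureGraph_adj_of_eq_add_one he hxs hy hb, ?_⟩
    rintro rfl
    rcases Sym2.mem_iff.1 hue with rfl | rfl <;> omega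
  exact ⟨y, ⟨mem_vertices_of_mem_edges he (Sym2.mem_mk_right x y), hy, by omega⟩, hadj,
    OrderDual.toDual_lt_toDual.2 (by omega)⟩

lemma mem_contour_diamond_iff {e e' : Sym2 Vertex} (he : e ∈ grid.edgeSet) :
    e' ∈ (diamond e).contour ↔ e' ≠ e ∧ ∃ t ∈ diamond e, e' ∈ t.sides := by
  rw [mem_contour_iff, Domain.edges, Finset.mem_biUnion, and_comm]
  refine and_congr_left fun ⟨t, _, he't⟩ => not_congr ⟨fun hsub => ?_, fun h => h ▸ subset_rfl⟩
  refine diamond_injOn (mem_edgeSet_of_mem_sides he't) he (Finset.eq_of_subset_of_card_le hsub ?_)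
  simp [diamond, upper_ne_lower]

lemma exists_isCycle_isDelimitedBy_diamond (huv : PosStep u v) :
    ∃ C : grid.Walk v v, C.IsCycle ∧ IsDelimitedBy (diamond s(u, v)) C := by
  have hupper := (mem_diamond_iff huv.adj).1 (upper_mem_diamond s(u, v))
  have hlower := (mem_diamond_iff huv.adj).1 (lower_mem_diamond s(u, v))
  obtain ⟨p, hvp, hpu, hp⟩ := exists_sides_eq_of_posStep huv hupper
  obtain ⟨q, hvq, hqu, hq⟩ := exists_sides_eq_of_posStep huv hlower
  have hvp_ne : s(v, p) ≠ s(u, v) := by simp [huv.ne.symm, hpu.ne]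
  have hpu_ne : s(p, u) ≠ s(u, v) := by simp [hvp.ne.symm, hpu.ne]
  have hvq_ne : s(q, v) ≠ s(u, v) := by simp [huv.ne.symm, hqu.ne]
  have huq_ne : s(u, q) ≠ s(u, v) := by simp [hvq.ne.symm, hqu.ne]
  have hpq : p ≠ q := by
    rintro rfl
    have hdiamond : diamond s(v, p) = diamond s(u, v) :=
      diamond_eq_pair (upper_ne_lower _ s(u, v)) (by simp [hp]) (by simp [hq])
    exact hvp_ne (diamond_injOn hvp.adj huv.adj hdiamond)
  refine ⟨.cons hvp.adj (.cons hpu.adj (.cons hqu.adj.symm (.cons hvq.adj.symm .nil))), ?_, ?_⟩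
  · simp [SimpleGraph.Walk.cons_isCycle_iff, hpq, huv.ne, huv.ne.symm, hvp.ne, hvp.ne.symm,
      hpu.ne, hvq.ne, hvq.ne.symm, hqu.ne.symm]
  · ext e
    have hsides : (∃ t ∈ diamond s(u, v), e ∈ t.sides) ↔
        e = s(u, v) ∨ e = s(v, p) ∨ e = s(p, u) ∨ e = s(u, q) ∨ e = s(q, v) := by
      simp only [diamond, Finset.mem_insert, Finset.mem_singleton, exists_eq_or_imp,
        exists_eq_left, hp, hq, Sym2.eq_swap (a := q) (b := u), Sym2.eq_swap (a := q) (b := v)]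
      tauto
    have hedges : e = s(v, p) ∨ e = s(p, u) ∨ e = s(u, q) ∨ e = s(q, v) → e ≠ s(u, v) := by
      rintro (rfl | rfl | rfl | rfl) <;> assumption
    rw [mem_contour_diamond_iff huv.adj, hsides]
    simp only [Set.mem_ofPred_eq, SimpleGraph.Walk.edges_cons, SimpleGraph.Walk.edges_nil,
      List.mem_cons, List.not_mem_nil, or_false]
    exact ⟨fun ⟨hne, h⟩ => h.resolve_left hne, fun h => ⟨hedges h, .inr h⟩⟩

lemma IsExtremalPair.contour_diamond_subset (hx : IsExtremalPair D A B a b)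
    (hD : HasConsistentHeights D) (huv : PosStep u v) (hu : IsSolid D u) (hv : IsSolid D v)
    (hFD : F ⊆ D) (hlF : diamond s(u, v) ⊆ F) (hlB : diamond s(u, v) ∈ B) :
    (diamond s(u, v)).contour ⊆ (fractureGraph D F b).edgeSet := by
  have he : s(u, v) ∈ D.edges := mem_edges_of_diamond_subset huv.adj (hlF.trans hFD)
  have hlA : diamond s(u, v) ∈ A := by
    by_contra hlA
    rw [← hx.heights.1.abs_sub_eq_one_iff hx.minimal.1 he, hu.sub_eq_sub hv hD he hx.minimal.1
      hx.maximal.1 hx.heights.1 hx.heights.2.1,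
      hx.heights.2.1.abs_sub_eq_one_iff hx.maximal.1 he] at hlA
    exact hlA hlB
  intro e' he'
  obtain ⟨hne, t, ht, he't⟩ := (mem_contour_diamond_iff huv.adj).1 he'
  have huvt := (mem_diamond_iff huv.adj).1 ht
  obtain ⟨w, hvw, hwu, hsides⟩ := exists_sides_eq_of_posStep huv huvt
  have hvwt : s(v, w) ∈ t.sides := by simp [hsides]
  have hwut : s(w, u) ∈ t.sides := by simp [hsides]
  have hvwF : s(v, w) ∈ F.edges := Finset.mem_biUnion.2 ⟨t, hlF ht, hvwt⟩
  have hwuF : s(w, u) ∈ F.edges := Finset.mem_biUnion.2 ⟨t, hlF ht, hwut⟩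
  have hvw_ne : s(v, w) ≠ s(u, v) := by simp [huv.ne.symm, hwu.ne]
  have hwu_ne : s(w, u) ≠ s(u, v) := by simp [hvw.ne.symm, hwu.ne]
  have ha := hx.heights.1.eq_add_one_of_mem_sides hx.minimal.1 hlA huvt hvw hvwt hvw_ne
  have hb := hx.heights.2.1.eq_add_one_of_mem_sides hx.maximal.1 hlB huvt hvw hvwt hvw_ne
  have hb' := hx.heights.2.1.eq_add_one_of_mem_sides hx.maximal.1 hlB huvt hwu hwut hwu_ne
  have hw : IsSolid D w := hx.isSolid (Domain.vertices_mono hFD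
    (mem_vertices_of_mem_edges hvwF (Sym2.mem_mk_right v w))) (by rw [ha, hb, hx.eq hD hv])
  simp only [hsides, Finset.mem_insert, Finset.mem_singleton, hne, false_or] at he't
  rcases he't with rfl | rfl
  exacts [fractureGraph_adj_of_eq_add_one hvwF hv hw hb,
    fractureGraph_adj_of_eq_add_one hwuF hw hu hb']

end FractureGraph

section FractureZones

variable {D F G : Domain} {T A B : Finset Domain} {h a b : Vertex → ℤ} {u v x y : Vertex}

lemma IsValidCycle.exists_isHeight {C : grid.Walk v v} (hC : IsValidCycle D T C) :
    ∃ h, IsHeight D T h ∧ ∀ x y, s(x, y) ∈ C.edges → |h y - h x| = 1 := by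
  obtain ⟨-, -, h, hh, hdarts⟩ := hC
  refine ⟨h, hh, fun x y he => ?_⟩
  obtain ⟨d, hd, hde⟩ := List.mem_map.1 he
  have hΔ := hdarts d hd
  rcases Sym2.eq_iff.1 (show s(d.fst, d.snd) = s(x, y) from hde) with ⟨hx, hy⟩ | ⟨hy, hx⟩
  · rwa [hx, hy] at hΔ
  · rwa [hx, hy, abs_sub_comm] at hΔ

lemma IsSubDomain.isTileable (hF : IsSubDomain D F) : IsTileable F := by
  obtain ⟨hFD, T, hT, v, C, hC, hdel⟩ := hF
  obtain ⟨h, hh, hΔ⟩ := hC.exists_isHeight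
  refine hT.isTileable_of_subset hFD ?_
  rintro ⟨x, y⟩ he
  exact (hh.abs_sub_eq_one_iff hT (Domain.edges_mono hFD (contour_subset_edges he))).1
    (hΔ x y (hdel.mem_contour_iff.1 he))

lemma IsSubDomain.exists_isCycle (hF : IsSubDomain D F) (hne : F.Nonempty) :
    ∃ (v : Vertex) (C : grid.Walk v v), C.IsCycle ∧ IsDelimitedBy F C := by
  obtain ⟨-, T, -, v, C, ⟨-, hC, -⟩, hdel⟩ := hF
  exact ⟨v, C, hdel.isCycle hne hC, hdel⟩

lemma IsSubDomain.isConnected (hF : IsSubDomain D F) (hne : F.Nonempty) : F.IsConnected := by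
  obtain ⟨v, C, hC, hdel⟩ := hF.exists_isCycle hne
  exact hdel.isConnected hC hne

/-- A chord of `F` is an edge of `F` off its contour joining two vertices of the contour. -/
def IsChord (F : Domain) (e : Sym2 Vertex) : Prop :=
  e ∈ F.edges ∧ e ∉ F.contour ∧ ∀ v ∈ e, v ∈ F.contourVertices

lemma IsTileable.innerVertices_nonempty (hF : IsTileable F) (hne : F.Nonempty)
    (hchord : ¬ ∃ e, IsChord F e) : F.innerVertices.Nonempty := by
  obtain ⟨T, hT⟩ := hF
  obtain ⟨t, ht⟩ := hne
  obtain ⟨e, he, heT, -⟩ := hT.exists_mem_diamond ht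
  have heF : e ∈ F.edges := mem_edges_of_diamond_subset he (hT.subset heT)
  have hcontour : e ∉ F.contour := fun hc => (mem_contour_iff.1 hc).2 (hT.subset heT)
  by_contra hempty
  refine hchord ⟨e, heF, hcontour, fun v hv => by_contra fun hvc => hempty ?_⟩
  exact ⟨v, mem_vertices_of_mem_edges heF hv, hvc⟩

namespace IsFractureZone

lemma isSubDomain (hF : IsFractureZone D F) : IsSubDomain D F := hF.1

lemma subset (hF : IsFractureZone D F) : F ⊆ D := hF.1.1

lemma nonempty (hF : IsFractureZone D F) : F.Nonempty := hF.2.1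

lemma isSolid_of_mem_contourVertices (hF : IsFractureZone D F) (hv : v ∈ F.contourVertices) :
    IsSolid D v := by
  obtain ⟨-, -, x, L, ⟨-, hsolid⟩, hdel, -⟩ := hF
  exact hsolid v (hdel.mem_support hv)

lemma contour_subset (hF : IsFractureZone D F) (hD : HasConsistentHeights D) (hT : IsTiling D T)
    (hh : IsHeight D T h) : F.contour ⊆ (fractureGraph D F h).edgeSet := by
  have hsolid : ∀ v ∈ F.contourVertices, IsSolid D v := fun _ =>
    hF.isSolid_of_mem_contourVertices
  obtain ⟨⟨hFD, -⟩, -, x, L, ⟨⟨T', hT', hL⟩, -⟩, hdel, -⟩ := hF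
  obtain ⟨h', hh', hΔ⟩ := hL.exists_isHeight
  rintro ⟨u, v⟩ he
  have heF := contour_subset_edges he
  have hu := hsolid u ⟨_, he, Sym2.mem_mk_left u v⟩
  have hv := hsolid v ⟨_, he, Sym2.mem_mk_right u v⟩
  refine ⟨heF, hu, hv, ?_⟩
  rw [hu.sub_eq_sub hv hD (Domain.edges_mono hFD heF) hT hT' hh hh']
  exact hΔ u v (hdel.mem_contour_iff.1 he)

lemma mem_contour_of_isCycle (hF : IsFractureZone D F) (hT : IsTiling D T) (hh : IsHeight D T h)
    {C : grid.Walk v v} (hC : C.IsCycle)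
    (hCh : ∀ e ∈ C.edges, e ∈ (fractureGraph D F h).edgeSet) {e : Sym2 Vertex}
    (he : e ∈ C.edges) : e ∈ F.contour := by
  obtain ⟨hline, hCF⟩ := isFractureLine_of_isCycle hF.subset hT hh hC hCh
  obtain ⟨-, -, x, L, -, hdel, huniq⟩ := hF
  exact hdel.mem_contour_iff.2 ((huniq v C hline hC.not_nil hCF e).1 he)

lemma reachable_of_mem_contourVertices (hF : IsFractureZone D F) (hD : HasConsistentHeights D)
    (hT : IsTiling D T) (hh : IsHeight D T h) {e : Sym2 Vertex} (he : e ∉ F.contour)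
    (hx : x ∈ F.contourVertices) (hy : y ∈ F.contourVertices) :
    ((fractureGraph D F h).deleteEdges {e}).Reachable x y := by
  have hsub := hF.contour_subset hD hT hh
  obtain ⟨-, -, z, L, -, hdel, -⟩ := hF
  have hL : ∀ e' ∈ L.edges, e' ∈ ((fractureGraph D F h).deleteEdges {e}).edgeSet := by
    intro e' he'
    have hc := hdel.mem_contour_iff.2 he'
    rw [SimpleGraph.edgeSet_deleteEdges]
    exact ⟨hsub hc, fun heq => he (heq ▸ hc)⟩
  exact (reachable_of_mem_support hL (hdel.mem_support hx)).symm.trans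
    (reachable_of_mem_support hL (hdel.mem_support hy))

lemma mem_contour_of_adj (hF : IsFractureZone D F) (hD : HasConsistentHeights D)
    (hT : IsTiling D T) (hh : IsHeight D T h) (huv : (fractureGraph D F h).Adj u v)
    (hx : x ∈ F.contourVertices)
    (hux : ((fractureGraph D F h).deleteEdges {s(u, v)}).Reachable u x)
    (hy : y ∈ F.contourVertices)
    (hvy : ((fractureGraph D F h).deleteEdges {s(u, v)}).Reachable v y) :
    s(u, v) ∈ F.contour := by
  -- Otherwise the edge, the two paths and an arc of the contour yield a second fracture line.
  by_contra he
  have hxy := hF.reachable_of_mem_contourVertices hD hT hh he hx hy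
  obtain ⟨w, C, hC, heC⟩ := SimpleGraph.adj_and_reachable_delete_edges_iff_exists_cycle.1
    ⟨huv, (hux.trans hxy).trans hvy.symm⟩
  have hedges := SimpleGraph.Walk.edges_mapLe_eq_edges fractureGraph_le C
  refine he (hF.mem_contour_of_isCycle hT hh (hC.mapLe fractureGraph_le) (fun e' he' => ?_)
    (hedges ▸ heC))
  rw [hedges] at he'
  exact C.edges_subset_edgeSet he'

lemma not_isSolid_of_mem_innerVertices (hF : IsFractureZone D F) (hD : HasConsistentHeights D)
    (hv : v ∈ F.innerVertices) : ¬ IsSolid D v := by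
  intro hsolid
  obtain ⟨A, B, a, b, hx⟩ := hsolid.exists_isExtremalPair
  obtain ⟨u, huv, hu, hb⟩ :=
    hx.exists_isSolid_posStep_to hD (innerVertices_mono hF.subset hv) hsolid
  have he := mem_edges_of_mem_innerVertices hv huv.adj (Sym2.mem_mk_right u v)
  have huF := mem_vertices_of_mem_edges he (Sym2.mem_mk_left u v)
  obtain ⟨y, hy, huy⟩ := hx.exists_reachable_below hD hF.subset (Sym2.mem_mk_right u v) huF hu
    (by omega)
  obtain ⟨z, hz, hvz⟩ := hx.exists_reachable_above hD hF.subset (Sym2.mem_mk_left u v) hv.1 hsolid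
    (by omega)
  exact hv.2 ⟨_, hF.mem_contour_of_adj hD hx.maximal.1 hx.heights.2.1
    (fractureGraph_adj_of_eq_add_one he hu hsolid hb) hy huy hz hvz, Sym2.mem_mk_right u v⟩

lemma isLozenge_of_isChord (hF : IsFractureZone D F) (hD : HasConsistentHeights D)
    {e : Sym2 Vertex} (he : IsChord F e) : IsLozenge F := by
  obtain ⟨heF, hec, hends⟩ := he
  have hgrid := mem_edgeSet_of_mem_edges heF
  have hlF : diamond e ⊆ F := by
    by_contra hl
    exact hec (mem_contour_iff.2 ⟨heF, hl⟩)
  obtain ⟨u, v, huv, rfl⟩ := exists_posStep_of_mem_edgeSet hgrid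
  have hu := hends u (Sym2.mem_mk_left u v)
  have hv := hends v (Sym2.mem_mk_right u v)
  have hus := hF.isSolid_of_mem_contourVertices hu
  have hvs := hF.isSolid_of_mem_contourVertices hv
  obtain ⟨A, B, a, b, hx⟩ := hus.exists_isExtremalPair
  have hB := hx.maximal.1
  have hb := hx.heights.2.1
  have hlB : diamond s(u, v) ∈ B := by
    by_contra hl
    have hΔ := (hb.abs_sub_eq_one_iff hB (Domain.edges_mono hF.subset heF)).2 hl
    exact hec (hF.mem_contour_of_adj hD hB hb ⟨heF, hus, hvs, hΔ⟩ hu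
      (SimpleGraph.Reachable.refl u) hv (SimpleGraph.Reachable.refl v))
  obtain ⟨C, hC, hdel⟩ := exists_isCycle_isDelimitedBy_diamond huv
  have hsub := hx.contour_diamond_subset hD huv hus hvs hF.subset hlF hlB
  have hcontour : (diamond s(u, v)).contour ⊆ F.contour := fun e he =>
    hF.mem_contour_of_isCycle hB hb hC (fun e' he' => hsub (hdel.mem_contour_iff.2 he'))
      (hdel.mem_contour_iff.1 he)
  obtain ⟨w, L, hL, hFL⟩ := hF.isSubDomain.exists_isCycle hF.nonempty
  exact isLozenge_iff_exists_diamond.2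
    ⟨_, hgrid, (hFL.eq_of_contour_subset hL ⟨_, upper_mem_diamond _⟩ hcontour).symm⟩

lemma isPreFertile (hF : IsFractureZone D F) (hD : HasConsistentHeights D)
    (hchord : ¬ ∃ e, IsChord F e) : IsPreFertile D F := by
  have htileable := hF.isSubDomain.isTileable
  refine ⟨hF.isSubDomain, hF.isSubDomain.isConnected hF.nonempty, htileable,
    htileable.innerVertices_nonempty hF.nonempty hchord,
    fun v hv hvc => hF.not_isSolid_of_mem_innerVertices hD ⟨hv, hvc⟩,
    fun u hu v hv => ⟨fun he => ?_, @contour_subset_edges F _⟩⟩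
  by_contra hc
  refine hchord ⟨_, he, hc, fun w hw => ?_⟩
  rcases Sym2.mem_iff.1 hw with rfl | rfl <;> assumption

lemma eq_of_isPreFertile_of_subset (hF : IsFractureZone D F) (hG : IsPreFertile D G)
    (hFG : F ⊆ G) : G = F := by
  obtain ⟨hGD, -, -, -, hinner, hiff⟩ := hG
  have hvertices : ∀ v ∈ F.contourVertices, v ∈ G.contourVertices := fun v hv => by
    have hvG := Domain.vertices_mono hFG (mem_vertices_of_mem_contourVertices hv)
    by_contra hvc
    exact hinner v hvG hvc (hF.isSolid_of_mem_contourVertices hv)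
  obtain ⟨v, C, hC, hdel⟩ := hGD.exists_isCycle (hF.nonempty.mono hFG)
  refine (hdel.eq_of_contour_subset hC hF.nonempty ?_).symm
  rintro ⟨x, y⟩ he
  have hx := hvertices x ⟨_, he, Sym2.mem_mk_left x y⟩
  have hy := hvertices y ⟨_, he, Sym2.mem_mk_right x y⟩
  exact (hiff x hx y hy).1 (Domain.edges_mono hFG (contour_subset_edges he))

end IsFractureZone

end FractureZones

end Lozenge

theorem mainTheorem4 (D : Lozenge.Domain) (hD : Lozenge.IsTileable D)
    (hheight : Lozenge.HasConsistentHeights D) (F : Lozenge.Domain)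
    (hF : Lozenge.IsFractureZone D F) :
    Lozenge.IsFertile D F ∨ Lozenge.IsLozenge F := by
  by_cases hchord : ∃ e, Lozenge.IsChord F e
  · obtain ⟨e, he⟩ := hchord
    exact .inr (hF.isLozenge_of_isChord hheight he)
  · exact .inl ⟨hF.isPreFertile hheight hchord, fun F' _ hG =>
      hF.eq_of_isPreFertile_of_subset hG Finset.subset_union_left⟩
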